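/- Let $n\ge 1$ and $k\ge 0$ be integers, and let $\mathcal H$ be the hyperplane in $\mathbb R^n$ given by $\sum_{i=1}^n a_ix_i=b$, where $a_1,\dots,a_n,b\in\mathbb Z$ and $\gcd(a_1,\dots,a_n)=1$. Call a lattice point $x\in\mathbb Z^n$ $k$-free if there is no prime $p$ with $p^k\mid\gcd(x_1,\dots,x_n)$ (where $\gcd(0,\dots,0)=0$). Then the density of $k$-free lattice points on $\mathcal H$ exists and $$\lim_{r\to\infty}\frac{\left|\{x\in\mathcal H\cap\mathbb Z^n\cap[-r,r]^n : x \text{ is } k\text{-free}\}\right|}{\left|\mathcal H\cap\mathbb Z^n\cap[-r,r]^n\right|}=\prod_{p^k\mid b}\left(1-\frac1{p^{k(n-1)}}\right),$$ where $r$ runs over the real numbers (the denominator is non-zero for all large $r$) and the product is over all primes $p$ with $p^k\mid b$. If there are infinitely many such primes (that is, if $b=0$ or $k=0$), the product is the limit of its finite partial products, which may be $0$. -/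

import Mathlib

open Filter Topology

/-- The hyperplane `a₁ x₁ + ⋯ + aₙ xₙ = b` in `ℝⁿ`. -/
def hyperplane {n : ℕ} (a : Fin n → ℤ) (b : ℤ) : Set (Fin n → ℝ) :=
  {x | ∑ i, (a i : ℝ) * x i = (b : ℝ)}

/-- The integral points of `Δ ∩ [-r, r]ⁿ`. -/
def latticePointsIn {n : ℕ} (Δ : Set (Fin n → ℝ)) (r : ℝ) : Set (Fin n → ℤ) :=
  {x | (fun i => (x i : ℝ)) ∈ Δ ∧ ∀ i, |(x i : ℝ)| ≤ r}

/-- There are finitely many such points, so that `Set.ncard` is the honest number of elements. -/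
theorem latticePointsIn_finite {n : ℕ} (Δ : Set (Fin n → ℝ)) (r : ℝ) :
    (latticePointsIn Δ r).Finite := by
  refine (Set.finite_Icc (fun _ : Fin n => -⌊r⌋) (fun _ => ⌊r⌋)).subset ?_
  rintro x ⟨-, hx⟩
  refine ⟨fun i => ?_, fun i => ?_⟩
  · have h : -x i ≤ ⌊r⌋ := Int.le_floor.2 (by push_cast; exact (neg_le_abs _).trans (hx i))
    show -⌊r⌋ ≤ x i
    linarith
  · exact Int.le_floor.2 ((le_abs_self _).trans (hx i))

/-- An integer is `k`-free if it is not divisible by the `k`-th power of a prime. -/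
def IsKFree (k : ℕ) (m : ℤ) : Prop :=
  ¬ ∃ p : ℕ, p.Prime ∧ (p : ℤ) ^ k ∣ m

/-- A lattice point is `k`-free if the gcd of its coordinates is. -/
def IsKFreePoint (k : ℕ) {n : ℕ} (x : Fin n → ℤ) : Prop :=
  IsKFree k (Finset.univ.gcd x)

/-- `Δ` has (asymptotic) density `ρ` of `k`-free lattice points: the proportion of `k`-free points
among the lattice points of `Δ ∩ [-r, r]ⁿ`, which is defined for all large `r`, tends to `ρ`
as `r → ∞`. -/
def HasKFreeDensity (k : ℕ) {n : ℕ} (Δ : Set (Fin n → ℝ)) (ρ : ℝ) : Prop :=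
  (∀ᶠ r : ℝ in atTop, (latticePointsIn Δ r).Nonempty) ∧
  Tendsto
    (fun r : ℝ => (({x ∈ latticePointsIn Δ r | IsKFreePoint k x}.ncard : ℕ) : ℝ) /
      (((latticePointsIn Δ r).ncard : ℕ) : ℝ))
    atTop (𝓝 ρ)

/-! As `r → ∞`, every hyperplane parallel to `a · x = 0` contains about `c r^(n-1)` lattice points
of the box, with one constant `c` for all integers `b` (`exists_tendsto_ncard_hyperplane_div_pow`).
Multiplication by `p^k` carries the hyperplane of `b / p^k` in the box of size `r / p^k` onto the
points of content divisible by `p^k`, so these have density `p^(-k(n-1))`. Sieving by finitely many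
primes therefore gives a finite partial product (`tendsto_ncard_sieved_div_pow`). Only primes with
`p^k ∣ b` matter, because the content divides `b`.

Finite sieves bound the `k`-free count from above. The lower bound is trivial if the product `ρ` is
`0`. If `ρ ≠ 0` and `b ≠ 0`, finitely many primes decide. If `ρ ≠ 0` and `b = 0`, then `k(n-1) ≥ 2`,
and large primes contribute at most a tail of `∑ 1/p²`. -/

/-! ### Counting lattice points on parallel hyperplanes -/

open Matrix in
-- Since `a · u = 1`, the kernel of `a` is a direct summand of `ℤⁿ`. The columns of `T` form a basis
-- of it, and `G` projects along `u` and reads off coordinates.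
theorem exists_kernel_parametrization {n : ℕ} {a : Fin n → ℤ} (ha : Finset.univ.gcd a = 1) :
    ∃ (u : Fin n → ℤ) (T : Matrix (Fin n) (Fin (n - 1)) ℤ) (G : Matrix (Fin (n - 1)) (Fin n) ℤ),
      a ⬝ᵥ u = 1 ∧ G * T = 1 ∧ a ᵥ* T = 0 ∧ ∀ x, a ⬝ᵥ x = 0 → T *ᵥ (G *ᵥ x) = x := by
  obtain ⟨u, hu⟩ := Finset.gcd_eq_sum_mul Finset.univ a
  have hu : a ⬝ᵥ u = 1 := by rw [← ha, hu]; rfl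
  let φ : (Fin n → ℤ) →ₗ[ℤ] ℤ :=
    { toFun := fun x => a ⬝ᵥ x
      map_add' := fun x y => dotProduct_add a x y
      map_smul' := fun c x => dotProduct_smul c a x }
  have hφ : ∀ x, φ x = a ⬝ᵥ x := fun _ => rfl
  have hsurj : LinearMap.range φ = ⊤ := LinearMap.range_eq_top.2 fun z => ⟨z • u, by
    rw [hφ, dotProduct_smul, hu, smul_eq_mul, mul_one]⟩
  have hrank : Module.finrank ℤ (LinearMap.ker φ) = n - 1 := by
    have := Submodule.finrank_quotient_add_finrank (LinearMap.ker φ)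
    rw [(φ.quotKerEquivOfSurjective (LinearMap.range_eq_top.1 hsurj)).finrank_eq,
      Module.finrank_self, Module.finrank_fin_fun] at this
    omega
  let B := Module.finBasisOfFinrankEq ℤ (LinearMap.ker φ) hrank
  let π : (Fin n → ℤ) →ₗ[ℤ] LinearMap.ker φ :=
    LinearMap.codRestrict _ (LinearMap.id - φ.smulRight u) fun x => by
      change φ (x - φ x • u) = 0
      rw [map_sub, map_smul, hφ u, hu, smul_eq_mul, mul_one, sub_self]
  have hπ : ∀ x (hx : φ x = 0), π x = ⟨x, hx⟩ := fun x hx => by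
    ext1; simp [π, hx]
  let τ : (Fin (n - 1) → ℤ) →ₗ[ℤ] (Fin n → ℤ) :=
    (LinearMap.ker φ).subtype ∘ₗ (B.equivFun.symm : (Fin (n - 1) → ℤ) →ₗ[ℤ] LinearMap.ker φ)
  let γ : (Fin n → ℤ) →ₗ[ℤ] (Fin (n - 1) → ℤ) :=
    (B.equivFun : LinearMap.ker φ →ₗ[ℤ] (Fin (n - 1) → ℤ)) ∘ₗ π
  have hτ : ∀ y, φ (τ y) = 0 := fun y => (B.equivFun.symm y).2
  refine ⟨u, LinearMap.toMatrix' τ, LinearMap.toMatrix' γ, hu, ?_, ?_, ?_⟩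
  · rw [← LinearMap.toMatrix'_comp, ← LinearMap.toMatrix'_id]
    congr 1
    refine LinearMap.ext fun y => ?_
    change B.equivFun (π (τ y)) = y
    rw [hπ _ (hτ y)]
    exact B.equivFun.apply_symm_apply y
  · ext j
    have := hτ (Pi.single j 1)
    rw [hφ, ← LinearMap.toMatrix'_mulVec, dotProduct_mulVec] at this
    simpa using this
  · intro x hx
    rw [LinearMap.toMatrix'_mulVec, LinearMap.toMatrix'_mulVec]
    change ((B.equivFun.symm (B.equivFun (π x)) : LinearMap.ker φ) : Fin n → ℤ) = x
    rw [LinearEquiv.symm_apply_apply, hπ x hx]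

open Matrix in
theorem mem_latticePointsIn_hyperplane {n : ℕ} {a : Fin n → ℤ} {b : ℤ} {r : ℝ} {x : Fin n → ℤ} :
    x ∈ latticePointsIn (hyperplane a b) r ↔ a ⬝ᵥ x = b ∧ ∀ i, |(x i : ℝ)| ≤ r := by
  refine and_congr_left fun _ => ?_
  simp only [hyperplane, Set.mem_ofPred_eq, dotProduct]
  exact_mod_cast Iff.rfl

open Matrix Pointwise in
/-- The points of the kernel lattice in a box are counted, to first order, by a volume. -/
theorem exists_tendsto_ncard_kernel_div_pow {n : ℕ} {a : Fin n → ℤ}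
    (ha : Finset.univ.gcd a = 1) :
    ∃ c : ℝ, 0 < c ∧ Tendsto
      (fun r : ℝ => ((latticePointsIn (hyperplane a 0) r).ncard : ℝ) / r ^ (n - 1))
      atTop (𝓝 c) := by
  obtain ⟨u, T, G, -, hGT, haT, hTG⟩ := exists_kernel_parametrization ha
  let T' : Matrix (Fin n) (Fin (n - 1)) ℝ := T.map (Int.castRingHom ℝ)
  let G' : Matrix (Fin (n - 1)) (Fin n) ℝ := G.map (Int.castRingHom ℝ)
  have hGT' : G' * T' = 1 := by
    rw [← Matrix.map_mul, hGT, Matrix.map_one _ (map_zero _) (map_one _)]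
  have castT : ∀ z : Fin (n - 1) → ℤ, T' *ᵥ (fun i => (z i : ℝ)) = fun i => ((T *ᵥ z) i : ℝ) :=
    fun z => by ext i; simp [T', Matrix.mulVec, dotProduct]
  have hcontT : Continuous fun y => T' *ᵥ y := by fun_prop
  have hcontG : Continuous fun y => G' *ᵥ y := by fun_prop
  -- The slice of the unit cube by the kernel, in kernel coordinates. It is bounded because `G'` is
  -- a left inverse of `T'`.
  let s : Set (Fin (n - 1) → ℝ) := (fun y => T' *ᵥ y) ⁻¹' Set.Icc (-1) 1
  have hs_mem : ∀ y, y ∈ s ↔ ∀ i, |(T' *ᵥ y) i| ≤ 1 := fun y => by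
    simp only [s, Set.mem_preimage, Set.mem_Icc, Pi.le_def, abs_le, ← forall_and]; rfl
  have hs_bdd : Bornology.IsBounded s := by
    have hbox : IsCompact (Set.Icc (-1 : Fin n → ℝ) 1) := isCompact_Icc
    refine (hbox.image hcontG).isBounded.subset fun y hy => ?_
    exact ⟨_, hy, by simp [Matrix.mulVec_mulVec, hGT']⟩
  have hs_closed : IsClosed s := isClosed_Icc.preimage hcontT
  have hs_conv : Convex ℝ s := (convex_Icc (-1) 1).linear_preimage (Matrix.mulVecLin T')
  have hs_zero : (0 : Fin (n - 1) → ℝ) ∈ s := (hs_mem 0).2 (by simp)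
  have hs_mono : ∀ ⦃x y : ℝ⦄, 0 < x → x ≤ y → x • s ⊆ y • s := by
    intro x y hx hxy
    have hy : 0 < y := hx.trans_le hxy
    rintro _ ⟨w, hw, rfl⟩
    refine ⟨(x / y) • w, hs_conv.smul_mem_of_zero_mem hs_zero hw
      ⟨by positivity, (div_le_one hy).2 hxy⟩, ?_⟩
    simp only [smul_smul]
    congr 1
    field_simp
  have hs_pos : 0 < MeasureTheory.volume s := by
    have hopen : IsOpen ((fun y => T' *ᵥ y) ⁻¹' (Metric.ball 0 1)) :=
      Metric.isOpen_ball.preimage hcontT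
    refine (hopen.measure_pos MeasureTheory.volume ⟨0, by simp⟩).trans_le
      (MeasureTheory.measure_mono fun y hy => (hs_mem y).2 fun i => ?_)
    have := norm_le_pi_norm (T' *ᵥ y) i
    have h2 : ‖T' *ᵥ y‖ < 1 := by simpa using hy
    exact (Real.norm_eq_abs _ ▸ this).trans h2.le
  refine ⟨MeasureTheory.volume.real s, ?_, ?_⟩
  · exact ENNReal.toReal_pos hs_pos.ne' hs_bdd.measure_lt_top.ne
  -- Convexity makes the frontier null; monotonicity of the dilates lets the limit run over real
  -- `r`.
  have key := tendsto_card_div_pow_atTop_volume' s hs_bdd hs_closed.measurableSet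
    (hs_conv.addHaar_frontier _) hs_mono
  rw [Fintype.card_fin] at key
  refine key.congr' ?_
  filter_upwards [eventually_gt_atTop 0] with r hr
  congr 2
  have himg : s ∩ r⁻¹ • (Submodule.span ℤ (Set.range (Pi.basisFun ℝ (Fin (n - 1)))) :
      Set (Fin (n - 1) → ℝ)) =
      (fun x : Fin n → ℤ => r⁻¹ • fun j => ((G *ᵥ x) j : ℝ)) ''
        latticePointsIn (hyperplane a 0) r := by
    have hscale : ∀ z : Fin (n - 1) → ℤ, (r⁻¹ • fun j => (z j : ℝ)) ∈ s ↔
        ∀ i, |((T *ᵥ z) i : ℝ)| ≤ r := fun z => by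
      rw [hs_mem]
      refine forall_congr' fun i => ?_
      rw [Matrix.mulVec_smul, castT, Pi.smul_apply, smul_eq_mul, abs_mul, abs_of_pos (by positivity),
        inv_mul_le_iff₀ hr, mul_one]
    ext y
    constructor
    · rintro ⟨hy, w, hw, rfl⟩
      rw [SetLike.mem_coe, (Pi.basisFun ℝ (Fin (n - 1))).mem_span_iff_repr_mem ℤ] at hw
      choose z hz using hw
      obtain rfl : (fun j => (z j : ℝ)) = w := by ext j; simpa using hz j
      refine ⟨T *ᵥ z, mem_latticePointsIn_hyperplane.2 ⟨?_, (hscale z).1 hy⟩, ?_⟩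
      · rw [dotProduct_mulVec, haT, zero_dotProduct]
      · simp only [Matrix.mulVec_mulVec, hGT, Matrix.one_mulVec]
    · rintro ⟨x, hx, rfl⟩
      obtain ⟨h0, hr'⟩ := mem_latticePointsIn_hyperplane.1 hx
      refine ⟨(hscale _).2 (by rwa [hTG x h0]), _, ?_, rfl⟩
      rw [SetLike.mem_coe, (Pi.basisFun ℝ (Fin (n - 1))).mem_span_iff_repr_mem ℤ]
      intro j
      exact ⟨(G *ᵥ x) j, by simp⟩
  rw [Nat.card_coe_set_eq, himg, Set.InjOn.ncard_image]
  intro x hx y hy hxy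
  have h : (fun j => ((G *ᵥ x) j : ℝ)) = fun j => ((G *ᵥ y) j : ℝ) :=
    smul_right_injective _ (inv_ne_zero hr.ne') hxy
  have h' : G *ᵥ x = G *ᵥ y := by ext j; exact_mod_cast congrFun h j
  rw [← hTG x (mem_latticePointsIn_hyperplane.1 hx).1, h',
    hTG y (mem_latticePointsIn_hyperplane.1 hy).1]

/-- Translation by `± b • u` exchanges the hyperplanes of `0` and `b` and changes the box size only
by a bounded `K`, which does not affect the leading term. -/
theorem exists_tendsto_ncard_hyperplane_div_pow {n : ℕ} {a : Fin n → ℤ}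
    (ha : Finset.univ.gcd a = 1) :
    ∃ c : ℝ, 0 < c ∧ ∀ b : ℤ, Tendsto
      (fun r : ℝ => ((latticePointsIn (hyperplane a b) r).ncard : ℝ) / r ^ (n - 1))
      atTop (𝓝 c) := by
  obtain ⟨c, hc, hlim⟩ := exists_tendsto_ncard_kernel_div_pow ha
  obtain ⟨u, -, -, hu, -⟩ := exists_kernel_parametrization ha
  refine ⟨c, hc, fun b => ?_⟩
  have hbu : a ⬝ᵥ (b • u) = b := by rw [dotProduct_smul, hu, smul_eq_mul, mul_one]
  have translate : ∀ (b b' : ℤ) (v : Fin n → ℤ) (r K : ℝ), a ⬝ᵥ v = b' - b → (∀ i, |(v i : ℝ)| ≤ K) →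
      (latticePointsIn (hyperplane a b) r).ncard ≤
        (latticePointsIn (hyperplane a b') (r + K)).ncard := by
    intro b b' v r K hv hK
    refine Set.ncard_le_ncard_of_injOn (· + v) ?_ (add_left_injective v).injOn
      (latticePointsIn_finite _ _)
    intro x hx
    obtain ⟨h1, h2⟩ := mem_latticePointsIn_hyperplane.1 hx
    refine mem_latticePointsIn_hyperplane.2 ⟨by rw [dotProduct_add, h1, hv]; ring, fun i => ?_⟩
    simp only [Pi.add_apply, Int.cast_add]
    exact (abs_add_le _ _).trans (add_le_add (h2 i) (hK i))
  obtain ⟨K, hK⟩ : ∃ K : ℝ, ∀ i, |((b • u) i : ℝ)| ≤ K :=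
    ⟨∑ i, |((b • u) i : ℝ)|, fun i => Finset.single_le_sum (f := fun i => |((b • u) i : ℝ)|)
      (fun _ _ => abs_nonneg _) (Finset.mem_univ i)⟩
  have shift : ∀ K : ℝ, Tendsto (fun r : ℝ =>
      ((latticePointsIn (hyperplane a 0) (r + K)).ncard : ℝ) / r ^ (n - 1)) atTop (𝓝 c) := by
    intro K
    have h1 : Tendsto (fun r : ℝ => r + K) atTop atTop := tendsto_atTop_add_const_right _ _ tendsto_id
    have h2 : Tendsto (fun r : ℝ => (1 + K / r) ^ (n - 1)) atTop (𝓝 1) := by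
      have := ((tendsto_const_nhds (x := K)).div_atTop (tendsto_id (α := ℝ) (x := atTop))).const_add 1
      simpa using this.pow (n - 1)
    have h3 := (hlim.comp h1).mul h2
    rw [mul_one] at h3
    refine h3.congr' ?_
    filter_upwards [eventually_gt_atTop 0, eventually_gt_atTop (-K)] with r hr hrK
    have : r + K ≠ 0 := by linarith
    have e : 1 + K / r = (r + K) / r := by field_simp
    simp only [Function.comp_apply]
    rw [e, div_pow]
    field_simp
  refine tendsto_of_tendsto_of_tendsto_of_le_of_le' (shift (-K)) (shift K) ?_ ?_
  · filter_upwards [eventually_gt_atTop 0] with r hr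
    refine div_le_div_of_nonneg_right (Nat.cast_le.2 ?_) (by positivity)
    simpa using translate 0 b (b • u) (r + -K) K (by rw [hbu, sub_zero]) hK
  · filter_upwards [eventually_gt_atTop 0] with r hr
    refine div_le_div_of_nonneg_right (Nat.cast_le.2 ?_) (by positivity)
    exact translate b 0 (-(b • u)) r K (by rw [dotProduct_neg, hbu, zero_sub]) (by simpa using hK)

/-! ### Sieving by finitely many primes -/

theorem dvd_gcd_smul_iff {ι : Type*} {s : Finset ι} {d e : ℤ} (h : IsCoprime d e) (x : ι → ℤ) :
    d ∣ s.gcd (e • x) ↔ d ∣ s.gcd x := by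
  simp only [Finset.dvd_gcd_iff, Pi.smul_apply, smul_eq_mul]
  exact forall₂_congr fun i _ => ⟨h.dvd_of_dvd_mul_left, fun hd => hd.mul_left _⟩

/-- Scaling by `d` identifies the points of one hyperplane with the points of content divisible
by `d` of another. -/
theorem image_smul_latticePointsIn {n : ℕ} (a : Fin n → ℤ) (b : ℤ) (r : ℝ) {d : ℤ} (hd : 0 < d) :
    (fun x => d • x) '' latticePointsIn (hyperplane a b) (r / d) =
      {x ∈ latticePointsIn (hyperplane a (d * b)) r | d ∣ Finset.univ.gcd x} := by
  have hd' : (0 : ℝ) < d := Int.cast_pos.2 hd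
  have hmem : ∀ x : Fin n → ℤ, d • x ∈ latticePointsIn (hyperplane a (d * b)) r ↔
      x ∈ latticePointsIn (hyperplane a b) (r / d) := fun x => by
    rw [mem_latticePointsIn_hyperplane, mem_latticePointsIn_hyperplane, dotProduct_smul,
      smul_eq_mul, mul_right_inj' hd.ne']
    refine and_congr_right fun _ => forall_congr' fun i => ?_
    rw [Pi.smul_apply, smul_eq_mul, Int.cast_mul, abs_mul, abs_of_pos hd', le_div_iff₀' hd']
  ext x
  constructor
  · rintro ⟨x, hx, rfl⟩
    exact ⟨(hmem x).2 hx, Finset.dvd_gcd fun i _ => dvd_mul_right _ _⟩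
  · rintro ⟨hx, hdx⟩
    choose y hy using fun i => hdx.trans (Finset.gcd_dvd (Finset.mem_univ i))
    obtain rfl : x = d • y := funext hy
    exact ⟨y, (hmem y).1 hx, rfl⟩

/-- Induction on `P` for all `b` at once: the points that survive `P` but are removed by `q` are
`q^k` times the survivors of `P` on the hyperplane of `b / q^k`. As `c` is the same there, the
factor `1 - q^(-k(n-1))` splits off. -/
theorem tendsto_ncard_sieved_div_pow {n : ℕ} {a : Fin n → ℤ} {c : ℝ}
    (hc : ∀ b : ℤ, Tendsto
      (fun r : ℝ => ((latticePointsIn (hyperplane a b) r).ncard : ℝ) / r ^ (n - 1))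
      atTop (𝓝 c)) (k : ℕ) (P : Finset ℕ) (hP : ∀ p ∈ P, p.Prime) (b : ℤ)
    (hPb : ∀ p ∈ P, (p : ℤ) ^ k ∣ b) :
    Tendsto (fun r : ℝ => ({x ∈ latticePointsIn (hyperplane a b) r |
        ∀ p ∈ P, ¬ (p : ℤ) ^ k ∣ Finset.univ.gcd x}.ncard : ℝ) / r ^ (n - 1))
      atTop (𝓝 (c * ∏ p ∈ P, (1 - 1 / (p : ℝ) ^ (k * (n - 1))))) := by
  induction P using Finset.induction generalizing b with
  | empty => simpa using hc b
  | insert q P hq ih =>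
    simp only [Finset.forall_mem_insert] at hP hPb
    obtain ⟨b', rfl⟩ := hPb.1
    have hcop : ∀ p ∈ P, IsCoprime ((p : ℤ) ^ k) ((q : ℤ) ^ k) := fun p hp =>
      (((Nat.coprime_primes (hP.2 p hp) hP.1).2 fun h => hq (h ▸ hp)).isCoprime).pow
    have hD : (0 : ℤ) < (q : ℤ) ^ k := pow_pos (by exact_mod_cast hP.1.pos) k
    have hDr : (0 : ℝ) < (q : ℝ) ^ k := by exact_mod_cast hD
    have h1 := ih hP.2 _ hPb.2
    have h2 := ih hP.2 b' fun p hp => (hcop p hp).dvd_of_dvd_mul_left (hPb.2 p hp)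
    have hscale : Tendsto (fun r : ℝ => r / (q : ℝ) ^ k) atTop atTop :=
      tendsto_id.atTop_div_const hDr
    have h3 := h1.sub ((h2.comp hscale).mul_const (1 / (q : ℝ) ^ (k * (n - 1))))
    rw [Finset.prod_insert hq]
    refine (h3.congr' ?_).trans (le_of_eq (by congr 1; ring))
    filter_upwards [eventually_gt_atTop 0] with r hr
    have hcount : {x ∈ latticePointsIn (hyperplane a ((q : ℤ) ^ k * b')) r |
          ∀ p ∈ P, ¬ (p : ℤ) ^ k ∣ Finset.univ.gcd x}.ncard =
        {x ∈ latticePointsIn (hyperplane a ((q : ℤ) ^ k * b')) r |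
          ∀ p ∈ insert q P, ¬ (p : ℤ) ^ k ∣ Finset.univ.gcd x}.ncard +
        {x ∈ latticePointsIn (hyperplane a b') (r / (q : ℝ) ^ k) |
          ∀ p ∈ P, ¬ (p : ℤ) ^ k ∣ Finset.univ.gcd x}.ncard := by
      have himg : (fun x => (q : ℤ) ^ k • x) ''
          {x ∈ latticePointsIn (hyperplane a b') (r / (q : ℝ) ^ k) |
            ∀ p ∈ P, ¬ (p : ℤ) ^ k ∣ Finset.univ.gcd x} =
          {x ∈ latticePointsIn (hyperplane a ((q : ℤ) ^ k * b')) r |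
            (q : ℤ) ^ k ∣ Finset.univ.gcd x ∧ ∀ p ∈ P, ¬ (p : ℤ) ^ k ∣ Finset.univ.gcd x} := by
        have := image_smul_latticePointsIn a b' r hD
        rw [Int.cast_pow, Int.cast_natCast] at this
        ext x
        constructor
        · rintro ⟨y, ⟨hy, hyP⟩, rfl⟩
          have hx := this.subset (Set.mem_image_of_mem _ hy)
          exact ⟨hx.1, hx.2, fun p hp => by
            rw [dvd_gcd_smul_iff (hcop p hp)]; exact hyP p hp⟩
        · rintro ⟨hx, hqx, hxP⟩
          obtain ⟨y, hy, rfl⟩ := this.superset ⟨hx, hqx⟩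
          exact ⟨y, ⟨hy, fun p hp => by
            have := hxP p hp; rwa [dvd_gcd_smul_iff (hcop p hp)] at this⟩, rfl⟩
      have hcard := congrArg Set.ncard himg
      rw [Set.InjOn.ncard_image (smul_right_injective _ hD.ne').injOn] at hcard
      rw [hcard, ← Set.ncard_union_eq ?_ ?_ ?_]
      · congr 1
        ext x
        simp only [Set.mem_ofPred_eq, Set.mem_union, Finset.forall_mem_insert]
        tauto
      · rw [Set.disjoint_left]
        rintro x ⟨-, hx⟩ ⟨-, hx', -⟩
        exact hx q (Finset.mem_insert_self _ _) hx'
      · exact (latticePointsIn_finite _ _).subset fun x hx => hx.1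
      · exact (latticePointsIn_finite _ _).subset fun x hx => hx.1
    rw [hcount, Function.comp_apply, div_pow, ← pow_mul]
    push_cast
    have : (q : ℝ) ^ (k * (n - 1)) ≠ 0 := by
      rw [pow_mul]; positivity
    field_simp
    ring

/-! ### The contribution of large primes when `b = 0` -/

/-- The bound must be uniform down to small `r`, as it is applied to `r / p^k`. The origin, which
lies in every box, is left out; for `r < 1` nothing else remains. -/
theorem exists_ncard_nonzero_le {n : ℕ} {a : Fin n → ℤ} {c : ℝ}
    (hc : Tendsto
      (fun r : ℝ => ((latticePointsIn (hyperplane a 0) r).ncard : ℝ) / r ^ (n - 1))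
      atTop (𝓝 c)) :
    ∃ C : ℝ, 0 ≤ C ∧ ∀ r : ℝ, 0 < r →
      ({x ∈ latticePointsIn (hyperplane a 0) r | x ≠ 0}.ncard : ℝ) ≤ C * r ^ (n - 1) := by
  obtain ⟨R, hR⟩ := eventually_atTop.1
    ((hc.eventually_le_const (lt_add_one c)).and (eventually_gt_atTop 0))
  have le_all : ∀ r : ℝ, {x ∈ latticePointsIn (hyperplane a 0) r | x ≠ 0}.ncard ≤
      (latticePointsIn (hyperplane a 0) r).ncard := fun r =>
    Set.ncard_le_ncard (fun x hx => hx.1) (latticePointsIn_finite _ _)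
  refine ⟨max (c + 1) (latticePointsIn (hyperplane a 0) R).ncard,
    le_max_of_le_right (Nat.cast_nonneg _), fun r hr => ?_⟩
  rcases le_total R r with hRr | hRr
  · calc ({x ∈ latticePointsIn (hyperplane a 0) r | x ≠ 0}.ncard : ℝ)
        ≤ (latticePointsIn (hyperplane a 0) r).ncard := Nat.cast_le.2 (le_all r)
      _ ≤ (c + 1) * r ^ (n - 1) := (div_le_iff₀ (by positivity)).1 (hR r hRr).1
      _ ≤ _ := by gcongr; exact le_max_left _ _
  rcases lt_or_ge r 1 with h1 | h1
  · have hempty : {x ∈ latticePointsIn (hyperplane a 0) r | x ≠ 0} = ∅ := by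
      refine Set.eq_empty_of_forall_notMem fun x ⟨hx, hx0⟩ => hx0 (funext fun i => ?_)
      have h := ((mem_latticePointsIn_hyperplane.1 hx).2 i).trans_lt h1
      exact Int.abs_lt_one_iff.1 (by exact_mod_cast h)
    rw [hempty, Set.ncard_empty, Nat.cast_zero]
    exact mul_nonneg (le_max_of_le_right (Nat.cast_nonneg _)) (by positivity)
  · have hmono : (latticePointsIn (hyperplane a 0) r).ncard ≤
        (latticePointsIn (hyperplane a 0) R).ncard :=
      Set.ncard_le_ncard (fun x hx => ⟨hx.1, fun i => (hx.2 i).trans hRr⟩)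
        (latticePointsIn_finite _ _)
    calc ({x ∈ latticePointsIn (hyperplane a 0) r | x ≠ 0}.ncard : ℝ)
        ≤ (latticePointsIn (hyperplane a 0) R).ncard := Nat.cast_le.2 ((le_all r).trans hmono)
      _ ≤ max (c + 1) (latticePointsIn (hyperplane a 0) R).ncard := le_max_right _ _
      _ ≤ _ := le_mul_of_one_le_right (le_max_of_le_right (Nat.cast_nonneg _)) (one_le_pow₀ h1)

/-- Few points are divisible by the `k`-th power of a large integer. -/
theorem ncard_large_divisor_le {n : ℕ} {a : Fin n → ℤ} {C : ℝ} (hC0 : 0 ≤ C)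
    (hC : ∀ r : ℝ, 0 < r →
      ({x ∈ latticePointsIn (hyperplane a 0) r | x ≠ 0}.ncard : ℝ) ≤ C * r ^ (n - 1))
    {k : ℕ} (hk : 2 ≤ k * (n - 1)) (M : ℕ) {r : ℝ} (hr : 0 < r) :
    ({x ∈ latticePointsIn (hyperplane a 0) r | x ≠ 0 ∧
        ∃ p : ℕ, M < p ∧ (p : ℤ) ^ k ∣ Finset.univ.gcd x}.ncard : ℝ) ≤
      C * r ^ (n - 1) * (2 / (M + 1)) := by
  have hk0 : k ≠ 0 := by rintro rfl; omega
  have hsub : {x ∈ latticePointsIn (hyperplane a 0) r | x ≠ 0 ∧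
        ∃ p : ℕ, M < p ∧ (p : ℤ) ^ k ∣ Finset.univ.gcd x} ⊆
      ⋃ p ∈ Finset.Ioo M (⌊r⌋₊ + 1), {x ∈ latticePointsIn (hyperplane a 0) r | x ≠ 0 ∧
        (p : ℤ) ^ k ∣ Finset.univ.gcd x} := by
    rintro x ⟨hx, hx0, p, hMp, hp⟩
    obtain ⟨i, hi⟩ := Function.ne_iff.1 hx0
    refine Set.mem_biUnion (x := p) ?_ ⟨hx, hx0, hp⟩
    -- A nonzero coordinate gives `p ≤ p^k ≤ |x i| ≤ r`, so only finitely many `p` occur.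
    have h1 : (p : ℤ) ^ k ≤ |x i| := Int.le_of_dvd (abs_pos.2 hi)
      ((dvd_abs _ _).2 (hp.trans (Finset.gcd_dvd (Finset.mem_univ i))))
    have h2 : p ≤ p ^ k := Nat.le_self_pow hk0 p
    have h3 : (p : ℝ) ≤ r := by
      have h4 : ((p ^ k : ℕ) : ℝ) ≤ |(x i : ℝ)| := by exact_mod_cast h1
      exact ((Nat.cast_le.2 h2).trans h4).trans (hx.2 i)
    simp only [Finset.coe_Ioo, Set.mem_Ioo]
    exact ⟨hMp, Nat.lt_succ_of_le (Nat.le_floor h3)⟩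
  have hterm : ∀ p ∈ Finset.Ioo M (⌊r⌋₊ + 1),
      ({x ∈ latticePointsIn (hyperplane a 0) r | x ≠ 0 ∧
        (p : ℤ) ^ k ∣ Finset.univ.gcd x}.ncard : ℝ) ≤ C * r ^ (n - 1) * ((p : ℝ) ^ 2)⁻¹ := by
    intro p hp
    have hp0 : 0 < p := (Nat.zero_le _).trans_lt (Finset.mem_Ioo.1 hp).1
    have hD : (0 : ℤ) < (p : ℤ) ^ k := by positivity
    have himg := image_smul_latticePointsIn a 0 r hD
    rw [mul_zero, Int.cast_pow, Int.cast_natCast] at himg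
    have hle : {x ∈ latticePointsIn (hyperplane a 0) r | x ≠ 0 ∧
        (p : ℤ) ^ k ∣ Finset.univ.gcd x}.ncard ≤
        {x ∈ latticePointsIn (hyperplane a 0) (r / (p : ℝ) ^ k) | x ≠ 0}.ncard := by
      refine le_trans (Set.ncard_le_ncard ?_ (Set.Finite.image (fun x => (p : ℤ) ^ k • x)
        ((latticePointsIn_finite _ _).subset fun x hx => hx.1))) (Set.ncard_image_le
        ((latticePointsIn_finite _ _).subset fun x hx => hx.1))
      rintro x ⟨hx, hx0, hpx⟩
      obtain ⟨y, hy, rfl⟩ := himg.superset ⟨hx, hpx⟩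
      exact ⟨y, ⟨hy, fun h => hx0 (by simp [h])⟩, rfl⟩
    refine (Nat.cast_le.2 hle).trans ((hC _ (by positivity)).trans ?_)
    rw [div_pow, ← pow_mul, mul_assoc, div_eq_mul_inv]
    -- The hypothesis `2 ≤ k * (n - 1)` enters here, to compare with `1/p²`.
    gcongr
    exact_mod_cast hp0
  calc _ ≤ ((∑ p ∈ Finset.Ioo M (⌊r⌋₊ + 1), {x ∈ latticePointsIn (hyperplane a 0) r | x ≠ 0 ∧
        (p : ℤ) ^ k ∣ Finset.univ.gcd x}.ncard : ℕ) : ℝ) := by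
        refine Nat.cast_le.2 ((Set.ncard_le_ncard hsub ?_).trans
          (Finset.set_ncard_biUnion_le _ _))
        exact (Finset.finite_toSet _).biUnion fun p _ =>
          (latticePointsIn_finite _ _).subset fun x hx => hx.1
    _ ≤ ∑ p ∈ Finset.Ioo M (⌊r⌋₊ + 1), C * r ^ (n - 1) * ((p : ℝ) ^ 2)⁻¹ := by
        push_cast
        exact Finset.sum_le_sum hterm
    _ ≤ _ := by
        rw [← Finset.mul_sum]
        gcongr
        exact sum_Ioo_inv_sq_le M (⌊r⌋₊ + 1)

/-! ### Convergence and vanishing of the product -/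

/-- An infinite product of factors in `[0, 1]` converges to a lower bound of its finite partial
products. -/
theorem exists_hasProd_of_mem_Icc {ι : Type*} {f : ι → ℝ} (hf : ∀ i, f i ∈ Set.Icc (0 : ℝ) 1) :
    ∃ ρ : ℝ, 0 ≤ ρ ∧ HasProd f ρ ∧ ∀ s : Finset ι, ρ ≤ ∏ i ∈ s, f i := by
  classical
  have hanti : Antitone fun s : Finset ι => ∏ i ∈ s, f i :=
    Finset.prod_anti_set_of_le_one (fun i => (hf i).1) fun i => (hf i).2
  have hbdd : BddBelow (Set.range fun s : Finset ι => ∏ i ∈ s, f i) :=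
    ⟨0, by rintro _ ⟨s, rfl⟩; exact Finset.prod_nonneg fun i _ => (hf i).1⟩
  refine ⟨⨅ s : Finset ι, ∏ i ∈ s, f i, le_ciInf fun s => Finset.prod_nonneg fun i _ => (hf i).1,
    ?_, fun s => ciInf_le hbdd s⟩
  rw [HasProd, SummationFilter.unconditional_filter]
  exact tendsto_atTop_ciInf hanti hbdd

/-- `1 - t ≤ exp (-t)`, and the sum of the reciprocals of the primes diverges. -/
theorem eq_zero_of_le_prod_one_sub_inv_prime {ρ : ℝ} (h0 : 0 ≤ ρ)
    (h : ∀ s : Finset Nat.Primes, ρ ≤ ∏ p ∈ s, (1 - 1 / (p : ℝ))) : ρ = 0 := by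
  by_contra hne
  have hpos : 0 < ρ := h0.lt_of_ne' hne
  refine Nat.Primes.not_summable_one_div
    (summable_of_sum_le (c := -Real.log ρ) (fun p => by positivity) fun s => ?_)
  have h1 : ρ ≤ Real.exp (-∑ p ∈ s, 1 / (p : ℝ)) := by
    rw [← Finset.sum_neg_distrib, Real.exp_sum]
    refine (h s).trans (Finset.prod_le_prod (fun p _ => ?_) fun p _ => ?_)
    · rw [sub_nonneg, div_le_one (by exact_mod_cast p.2.pos)]
      exact_mod_cast p.2.one_le
    · linarith [Real.add_one_le_exp (-(1 / (p : ℝ)))]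
  linarith [(Real.log_le_iff_le_exp hpos).2 h1]

/-! ### Comparing `k`-free points with sieved points -/

theorem isKFreePoint_iff {k n : ℕ} {x : Fin n → ℤ} :
    IsKFreePoint k x ↔ ∀ p : ℕ, p.Prime → ¬ (p : ℤ) ^ k ∣ Finset.univ.gcd x := by
  simp [IsKFreePoint, IsKFree]

/-- The content of a lattice point on the hyperplane divides the right-hand side. -/
theorem gcd_dvd_of_mem_latticePointsIn {n : ℕ} {a : Fin n → ℤ} {b : ℤ} {r : ℝ} {x : Fin n → ℤ}
    (hx : x ∈ latticePointsIn (hyperplane a b) r) : Finset.univ.gcd x ∣ b := by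
  rw [← (mem_latticePointsIn_hyperplane.1 hx).1]
  exact Finset.dvd_sum fun i hi => (Finset.gcd_dvd hi).mul_left _

theorem ncard_isKFreePoint_le_sieved {n : ℕ} (a : Fin n → ℤ) (b : ℤ) (k : ℕ) {P : Finset ℕ}
    (hP : ∀ p ∈ P, p.Prime) (r : ℝ) :
    {x ∈ latticePointsIn (hyperplane a b) r | IsKFreePoint k x}.ncard ≤
      {x ∈ latticePointsIn (hyperplane a b) r |
        ∀ p ∈ P, ¬ (p : ℤ) ^ k ∣ Finset.univ.gcd x}.ncard :=
  Set.ncard_le_ncard (fun _ hx => ⟨hx.1, fun p hp => isKFreePoint_iff.1 hx.2 p (hP p hp)⟩)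
    ((latticePointsIn_finite _ _).subset fun _ hx => hx.1)

/-- For a nonzero right-hand side finitely many primes decide whether a point is `k`-free. -/
theorem exists_sieved_le_of_ne_zero {n : ℕ} (a : Fin n → ℤ) {b : ℤ} (hb : b ≠ 0) {k : ℕ}
    (hk : k ≠ 0) :
    ∃ P : Finset ℕ, (∀ p ∈ P, p.Prime ∧ (p : ℤ) ^ k ∣ b) ∧ ∀ r : ℝ,
      {x ∈ latticePointsIn (hyperplane a b) r |
        ∀ p ∈ P, ¬ (p : ℤ) ^ k ∣ Finset.univ.gcd x}.ncard ≤
      {x ∈ latticePointsIn (hyperplane a b) r | IsKFreePoint k x}.ncard := by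
  classical
  refine ⟨{p ∈ Finset.range (b.natAbs + 1) | p.Prime ∧ (p : ℤ) ^ k ∣ b},
    fun p hp => (Finset.mem_filter.1 hp).2, fun r => Set.ncard_le_ncard ?_
      ((latticePointsIn_finite _ _).subset fun x hx => hx.1)⟩
  rintro x ⟨hx, hxP⟩
  refine ⟨hx, isKFreePoint_iff.2 fun p hp hpx => hxP p ?_ hpx⟩
  have hpb : (p : ℤ) ^ k ∣ b := hpx.trans (gcd_dvd_of_mem_latticePointsIn hx)
  have hle : p ^ k ≤ b.natAbs := Nat.le_of_dvd (Int.natAbs_pos.2 hb)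
    (Int.natCast_dvd.1 (by exact_mod_cast hpb))
  exact Finset.mem_filter.2 ⟨Finset.mem_range.2
    (Nat.lt_succ_of_le ((Nat.le_self_pow hk p).trans hle)), hp, hpb⟩

theorem exists_sieved_le_of_two_le {n : ℕ} {a : Fin n → ℤ} {c : ℝ}
    (hc : Tendsto
      (fun r : ℝ => ((latticePointsIn (hyperplane a 0) r).ncard : ℝ) / r ^ (n - 1))
      atTop (𝓝 c)) {k : ℕ} (hk : 2 ≤ k * (n - 1)) {ε : ℝ} (hε : 0 < ε) :
    ∃ P : Finset ℕ, (∀ p ∈ P, p.Prime) ∧ ∀ᶠ r : ℝ in atTop,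
      ({x ∈ latticePointsIn (hyperplane a 0) r |
        ∀ p ∈ P, ¬ (p : ℤ) ^ k ∣ Finset.univ.gcd x}.ncard : ℝ) ≤
      {x ∈ latticePointsIn (hyperplane a 0) r | IsKFreePoint k x}.ncard + ε * r ^ (n - 1) := by
  classical
  obtain ⟨C, hC0, hC⟩ := exists_ncard_nonzero_le hc
  obtain ⟨M, hM⟩ : ∃ M : ℕ, C * (2 / ((M : ℝ) + 1)) ≤ ε / 2 := by
    obtain ⟨M, hM⟩ := exists_nat_ge (4 * C / ε)
    refine ⟨M, ?_⟩
    rw [div_le_iff₀ hε] at hM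
    rw [mul_div_assoc', div_le_iff₀ (by positivity)]
    nlinarith
  have hn : n - 1 ≠ 0 := fun h => by simp [h] at hk
  refine ⟨{p ∈ Finset.range (M + 1) | p.Prime}, fun p hp => (Finset.mem_filter.1 hp).2, ?_⟩
  filter_upwards [eventually_gt_atTop 0,
    -- One half of `ε` pays for the origin, which the tail bound does not cover; the other half pays
    -- for the primes above `M`.
    ((tendsto_pow_atTop hn).const_mul_atTop (half_pos hε)).eventually_ge_atTop 1] with r hr hr1
  have hsub : {x ∈ latticePointsIn (hyperplane a 0) r |
        ∀ p ∈ ({p ∈ Finset.range (M + 1) | p.Prime} : Finset ℕ),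
          ¬ (p : ℤ) ^ k ∣ Finset.univ.gcd x} ⊆
      ({x ∈ latticePointsIn (hyperplane a 0) r | IsKFreePoint k x} ∪ {0}) ∪
      {x ∈ latticePointsIn (hyperplane a 0) r | x ≠ 0 ∧
        ∃ p : ℕ, M < p ∧ (p : ℤ) ^ k ∣ Finset.univ.gcd x} := by
    rintro x ⟨hx, hxP⟩
    by_cases hx0 : x = 0
    · exact Or.inl (Or.inr hx0)
    by_cases hfree : IsKFreePoint k x
    · exact Or.inl (Or.inl ⟨hx, hfree⟩)
    rw [isKFreePoint_iff] at hfree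
    push Not at hfree
    obtain ⟨p, hp, hpx⟩ := hfree
    refine Or.inr ⟨hx, hx0, p, ?_, hpx⟩
    by_contra hle
    exact hxP p (Finset.mem_filter.2 ⟨Finset.mem_range.2 (by omega), hp⟩) hpx
  have hcard := (Set.ncard_le_ncard hsub (((((latticePointsIn_finite _ _).subset
    fun x hx => hx.1).union (Set.finite_singleton 0)).union
    ((latticePointsIn_finite _ _).subset fun x hx => hx.1)))).trans ((Set.ncard_union_le _ _).trans
      (Nat.add_le_add_right (Set.ncard_union_le _ _) _))
  rw [Set.ncard_singleton] at hcard
  have hcard' := (Nat.cast_le (α := ℝ)).2 hcard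
  push_cast at hcard'
  have htail := ncard_large_divisor_le hC0 hC hk M hr
  have hM' := mul_le_mul_of_nonneg_right hM (pow_nonneg hr.le (n - 1))
  refine hcard'.trans ?_
  linarith [mul_right_comm C (r ^ (n - 1)) (2 / ((M : ℝ) + 1))]

/-! ### The density theorem -/

theorem corollary4p3 (n : ℕ) (a : Fin n → ℤ) (b : ℤ) (k : ℕ)
    (ha : Finset.univ.gcd a = 1) :
    ∃ ρ : ℝ,
      HasProd
        (fun p : {p : ℕ // p.Prime ∧ (p : ℤ) ^ k ∣ b} =>
          1 - 1 / ((p : ℕ) : ℝ) ^ (k * (n - 1))) ρ ∧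
      HasKFreeDensity k (hyperplane a b) ρ := by
  classical
  obtain ⟨c, hc0, hc⟩ := exists_tendsto_ncard_hyperplane_div_pow ha
  obtain ⟨ρ, hρ0, hρ, hρle⟩ := exists_hasProd_of_mem_Icc
    (f := fun p : {p : ℕ // p.Prime ∧ (p : ℤ) ^ k ∣ b} => 1 - 1 / ((p : ℕ) : ℝ) ^ (k * (n - 1)))
    (fun p => by
      have h1 : (1 : ℝ) ≤ ((p : ℕ) : ℝ) ^ (k * (n - 1)) :=
        one_le_pow₀ (by exact_mod_cast p.2.1.one_le)
      exact ⟨sub_nonneg.2 ((div_le_one (by positivity)).2 h1), sub_le_self _ (by positivity)⟩)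
  refine ⟨ρ, hρ, ?_, ?_⟩
  · filter_upwards [(hc b).eventually_ne hc0.ne'] with r hr
    refine Set.nonempty_of_ncard_ne_zero fun h => hr (by rw [h, Nat.cast_zero, zero_div])
  have hρle' : ∀ P : Finset ℕ, (∀ p ∈ P, p.Prime ∧ (p : ℤ) ^ k ∣ b) →
      ρ ≤ ∏ p ∈ P, (1 - 1 / (p : ℝ) ^ (k * (n - 1))) := fun P hP => by
    rw [← Finset.prod_subtype_of_mem (fun p : ℕ => 1 - 1 / (p : ℝ) ^ (k * (n - 1))) hP]
    exact hρle _
  have lower : ρ ≠ 0 → ∀ ε : ℝ, 0 < ε → ∃ P : Finset ℕ,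
      (∀ p ∈ P, p.Prime ∧ (p : ℤ) ^ k ∣ b) ∧ ∀ᶠ r : ℝ in atTop,
      ({x ∈ latticePointsIn (hyperplane a b) r |
        ∀ p ∈ P, ¬ (p : ℤ) ^ k ∣ Finset.univ.gcd x}.ncard : ℝ) ≤
      {x ∈ latticePointsIn (hyperplane a b) r | IsKFreePoint k x}.ncard + ε * r ^ (n - 1) := by
    intro hne ε hε
    -- With exponent `0`, the factor at the prime `2` is `1 - 1 = 0`.
    have exponent_ne_zero : (2 : ℤ) ^ k ∣ b → k * (n - 1) ≠ 0 := fun h2 h => hne <|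
      le_antisymm (by simpa [h] using hρle' {2} (by simpa [Nat.prime_two] using h2)) hρ0
    have hk : k ≠ 0 := by
      rintro rfl
      exact exponent_ne_zero (by simp) (zero_mul _)
    by_cases hb : b = 0
    · subst hb
      have h0 := exponent_ne_zero (dvd_zero _)
      have h1 : k * (n - 1) ≠ 1 := fun h => hne <|
        eq_zero_of_le_prod_one_sub_inv_prime hρ0 fun s => by
          let e : Nat.Primes ↪ ℕ := ⟨fun p => p, Nat.Primes.coe_nat_injective⟩
          have := hρle' (s.map e) fun p hp => by
            obtain ⟨q, -, rfl⟩ := Finset.mem_map.1 hp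
            exact ⟨q.2, dvd_zero _⟩
          rw [Finset.prod_map] at this
          simp only [h, pow_one] at this
          exact this
      obtain ⟨P, hP, h⟩ := exists_sieved_le_of_two_le (hc 0) (k := k) (by omega) hε
      exact ⟨P, fun p hp => ⟨hP p hp, dvd_zero _⟩, h⟩
    · obtain ⟨P, hP, h⟩ := exists_sieved_le_of_ne_zero a hb hk
      refine ⟨P, hP, ?_⟩
      filter_upwards [eventually_ge_atTop 0] with r hr
      exact (Nat.cast_le.2 (h r)).trans (le_add_of_nonneg_right (by positivity))
  have main : Tendsto (fun r : ℝ =>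
      ({x ∈ latticePointsIn (hyperplane a b) r | IsKFreePoint k x}.ncard : ℝ) / r ^ (n - 1))
      atTop (𝓝 (c * ρ)) := by
    refine tendsto_order.2 ⟨fun y hy => ?_, fun y hy => ?_⟩
    · rcases eq_or_ne ρ 0 with h0 | hne
      · filter_upwards [eventually_ge_atTop 0] with r hr
        rw [h0, mul_zero] at hy
        exact hy.trans_le (by positivity)
      -- The error is half the gap between `y` and `c * ρ`, so a sieved density above the midpoint
      -- leaves more than `y`.
      · obtain ⟨P, hP, hPr⟩ := lower hne ((c * ρ - y) / 2) (by linarith)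
        have hlim := tendsto_ncard_sieved_div_pow hc k P (fun p hp => (hP p hp).1) b
          fun p hp => (hP p hp).2
        have hlt : (y + c * ρ) / 2 < c * ∏ p ∈ P, (1 - 1 / (p : ℝ) ^ (k * (n - 1))) :=
          lt_of_lt_of_le (by linarith) (mul_le_mul_of_nonneg_left (hρle' P hP) hc0.le)
        filter_upwards [hPr, hlim.eventually_const_lt hlt, eventually_gt_atTop 0] with r h1 h2 hr
        have hr' : 0 < r ^ (n - 1) := by positivity
        rw [lt_div_iff₀ hr'] at h2 ⊢
        linarith
    · have hy' : ρ < y / c := by rwa [lt_div_iff₀' hc0]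
      obtain ⟨s, hs⟩ := (hρ.eventually_lt_const hy').exists
      have hP : ∀ p ∈ s.map ⟨Subtype.val, Subtype.val_injective⟩, p.Prime ∧ (p : ℤ) ^ k ∣ b :=
        fun p hp => by
          obtain ⟨q, -, rfl⟩ := Finset.mem_map.1 hp
          exact q.2
      have hlim := tendsto_ncard_sieved_div_pow hc k _ (fun p hp => (hP p hp).1) b
        fun p hp => (hP p hp).2
      rw [Finset.prod_map] at hlim
      filter_upwards [hlim.eventually_lt_const ((lt_div_iff₀' hc0).1 hs),
        eventually_gt_atTop 0] with r h1 hr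
      refine lt_of_le_of_lt ?_ h1
      exact div_le_div_of_nonneg_right
        (Nat.cast_le.2 (ncard_isKFreePoint_le_sieved a b k (fun p hp => (hP p hp).1) r))
        (by positivity)
  have hquot := main.div (hc b) hc0.ne'
  rw [mul_div_cancel_left₀ _ hc0.ne'] at hquot
  refine hquot.congr' ?_
  filter_upwards [eventually_gt_atTop 0] with r hr
  exact div_div_div_cancel_right₀ (by positivity) _ _
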